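/- All graphs are finite and simple. A graph $G$ is a *nut graph* if the kernel of its adjacency matrix over $\mathbb{R}$ is one-dimensional and every nonzero vector of this kernel has no zero entry. Write $o_v(G)$ and $o_e(G)$ for the numbers of orbits of the full automorphism group $\mathrm{Aut}(G)$ on the vertices and on the edges of $G$. For $m \ge 1$ and $n \ge 2m+3$ let $\mathrm{Circ}(n,\{1,\dots,m\})$ be the graph on $\mathbb{Z}_n$ in which distinct $u,v$ are adjacent if and only if $u-v$ or $v-u$ lies in $\{1,\dots,m\}$ modulo $n$. For a $2t$-regular graph $G$ and $\ell \ge 3$ let $\mathcal{M}_\ell(G)$ be the graph obtained from $G$ by attaching to every vertex $v$ of $G$ exactly $t$ new cycles of length $\ell$, any two of which share only the vertex $v$, and each of which meets $G$ only in $v$. **Theorem.** 1. Let $r \ge 2$ be even. For every $k \ge r+1$ there exist infinitely many pairwise non-isomorphic nut graphs $G$ with $o_v(G) = r$ and $o_e(G) = k$. 2. For all $m \ge 1$ and $n \ge 2m+3$ the graph $\mathrm{Circ}(n,\{1,\dots,m\})$ is $2m$-regular and its automorphism group is isomorphic to the dihedral group of order $2n$. 3. For all $q \ge 1$, $m \ge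 1$ and $n \ge 2m+3$ the graph $G = \mathcal{M}_{4q-1}(\mathrm{Circ}(n,\{1,\dots,m\}))$ is a nut graph with $o_v(G) = 2q$ and $o_e(G) = m+2q$. -/

import Mathlib

namespace NutGraph

/-- A finite graph is a nut graph if the kernel of its (real) adjacency matrix is one-dimensional
and every nonzero vector of the kernel has only nonzero entries. -/
def IsNut {V : Type*} [Fintype V] (G : SimpleGraph V) : Prop :=
  letI := Classical.decEq V
  letI := Classical.decRel G.Adj
  Module.finrank ℝ (LinearMap.ker (G.adjMatrix ℝ).mulVecLin) = 1 ∧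
    ∀ x ∈ LinearMap.ker (G.adjMatrix ℝ).mulVecLin, x ≠ 0 → ∀ v, x v ≠ 0

/-- Two vertices are equivalent if some automorphism of `G` maps one to the other. -/
def vertexOrbitSetoid {V : Type*} (G : SimpleGraph V) : Setoid V where
  r u v := ∃ α : G ≃g G, α u = v
  iseqv :=
    { refl := fun u => ⟨RelIso.refl _, rfl⟩
      symm := by
        rintro u v ⟨α, rfl⟩
        exact ⟨α.symm, α.symm_apply_apply u⟩
      trans := by
        rintro u v w ⟨α, rfl⟩ ⟨β, rfl⟩
        exact ⟨α.trans β, rfl⟩ }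

/-- Two edges are equivalent if some automorphism of `G` maps one to the other. -/
def edgeOrbitSetoid {V : Type*} (G : SimpleGraph V) : Setoid G.edgeSet where
  r e f := ∃ α : G ≃g G, Sym2.map α e.1 = f.1
  iseqv :=
    { refl := fun e => ⟨RelIso.refl _, by
        change Sym2.map id e.1 = e.1
        rw [Sym2.map_id, id]⟩
      symm := by
        rintro e f ⟨α, h⟩
        refine ⟨α.symm, ?_⟩
        rw [← h, Sym2.map_map]
        have hid : (α.symm ∘ α : V → V) = id := funext fun u => α.symm_apply_apply u
        rw [hid, Sym2.map_id, id]
      trans := by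
        rintro e f g ⟨α, h⟩ ⟨β, h2⟩
        refine ⟨α.trans β, ?_⟩
        rw [← h2, ← h, Sym2.map_map]
        rfl }

/-- The number of vertex orbits of the full automorphism group of `G`. -/
noncomputable def numVertexOrbits {V : Type*} (G : SimpleGraph V) : ℕ :=
  Nat.card (Quotient (vertexOrbitSetoid G))

/-- The number of edge orbits of the full automorphism group of `G`. -/
noncomputable def numEdgeOrbits {V : Type*} (G : SimpleGraph V) : ℕ :=
  Nat.card (Quotient (edgeOrbitSetoid G))

/-- The circulant graph on `ℤ/nℤ` with connection set `{1, …, m}` (symmetrized). -/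
def circ (n m : ℕ) : SimpleGraph (ZMod n) :=
  SimpleGraph.circulantGraph {x : ZMod n | ∃ i : ℕ, 1 ≤ i ∧ i ≤ m ∧ x = (i : ZMod n)}

/-- Adjacency for `multiplier`. The `j`-th cycle fused at `v` is
`v, (v, j, 0), (v, j, 1), …, (v, j, k - 2), v`. -/
def multiplierAdj {V : Type*} (G : SimpleGraph V) (t k : ℕ) :
    V ⊕ V × Fin t × Fin (k - 1) → V ⊕ V × Fin t × Fin (k - 1) → Prop
  | .inl u, .inl v => G.Adj u v
  | .inl u, .inr (v, _, i) => u = v ∧ (i.val = 0 ∨ i.val + 2 = k)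
  | .inr (v, _, i), .inl u => u = v ∧ (i.val = 0 ∨ i.val + 2 = k)
  | .inr (u, j, i), .inr (v, j', i') =>
      u = v ∧ j = j' ∧ (i.val + 1 = i'.val ∨ i'.val + 1 = i.val)

/-- The `k`-multiplier of a `2t`-regular graph `G` (`k ≥ 3`): a bouquet of `t` cycles of length `k`
is fused to every vertex of `G`. -/
def multiplier {V : Type*} (G : SimpleGraph V) (t k : ℕ) :
    SimpleGraph (V ⊕ V × Fin t × Fin (k - 1)) where
  Adj := multiplierAdj G t k
  symm := ⟨by
    rintro (u | ⟨u, j, i⟩) (v | ⟨v, j', i'⟩) h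
    · exact SimpleGraph.Adj.symm h
    · exact h
    · exact h
    · exact ⟨h.1.symm, h.2.1.symm, h.2.2.symm⟩⟩
  loopless := ⟨by
    rintro (u | ⟨u, j, i⟩) h
    · exact G.loopless.irrefl u h
    · rcases h.2.2 with h | h <;> omega⟩

end NutGraph

namespace NutGraph

/-! ### Circulants and their automorphisms -/

section Circulant

variable {n m : ℕ}

/-! Circulant. Closed neighbourhoods are cyclic intervals of length `2m + 1 ≤ n - 2`, so distinct
`u`, `v` are cyclically consecutive exactly when `N[u] \ N[v]` has at most one element
(`circ_consecutive_iff`). Automorphisms therefore preserve the underlying `n`-cycle and have the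
form `x ↦ ±x + c`.

Kernel. Around an attached cycle the kernel equation reads `y i + y (i + 2) = 0`. Length `4q - 1`
forces the pattern `+, -, -, +, …` scaled by the value at the base vertex `v`, so both cycle
neighbours of `v` carry `-x v`. The `t` cycles at `v` contribute `-2t * x v`, and the equation at
`v` says that `x` is harmonic on the connected `2t`-regular base. Hence `x` is constant there, and
the kernel is a line spanned by a vector with entries `±1`.

Orbits. Distance to the base (`depth`) is an invariant, because only base vertices have three
neighbours. Base symmetries, permutations of the cycles and their reversal lift to the multiplier,
so depths `0, …, 2q - 1` are the vertex orbits. Edges split into `m` classes of chord lengths and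
`2q` classes along a cycle. Letting `n` grow gives infinitely many examples. -/

theorem circ_adj (h : 2 * m + 3 ≤ n) {u v : ZMod n} :
    (circ n m).Adj u v ↔ ∃ i : ℕ, 1 ≤ i ∧ i ≤ m ∧ (v = u + i ∨ u = v + i) := by
  have hne : ∀ i : ℕ, 1 ≤ i → i ≤ m → (i : ZMod n) ≠ 0 := by
    intro i h1 h2 h0
    rw [ZMod.natCast_eq_zero_iff] at h0
    have := Nat.le_of_dvd (by omega) h0
    omega
  simp only [circ, SimpleGraph.circulantGraph, SimpleGraph.fromRel_adj, Set.mem_ofPred_eq]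
  constructor
  · rintro ⟨-, ⟨i, h1, h2, h3⟩ | ⟨i, h1, h2, h3⟩⟩
    · exact ⟨i, h1, h2, Or.inr (by rw [← h3]; ring)⟩
    · exact ⟨i, h1, h2, Or.inl (by rw [← h3]; ring)⟩
  · rintro ⟨i, h1, h2, rfl | rfl⟩
    · exact ⟨fun h => hne i h1 h2 (by simpa using h), Or.inr ⟨i, h1, h2, by ring⟩⟩
    · exact ⟨fun h => hne i h1 h2 (by simpa using h), Or.inl ⟨i, h1, h2, by ring⟩⟩

theorem circ_adj_add_one (hm : 1 ≤ m) (h : 2 * m + 3 ≤ n) (u : ZMod n) :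
    (circ n m).Adj u (u + 1) :=
  (circ_adj h).2 ⟨1, le_rfl, hm, Or.inl (by simp)⟩

theorem eq_of_intCast_eq {a b : ℤ} (h : |a - b| < n) (hab : (a : ZMod n) = b) : a = b := by
  rw [eq_comm, ZMod.intCast_eq_intCast_iff_dvd_sub] at hab
  exact sub_eq_zero.1 (Int.eq_zero_of_abs_lt_dvd hab h)

theorem circ_neighborSet (h : 2 * m + 3 ≤ n) (v : ZMod n) :
    (circ n m).neighborSet v =
      (fun i : ℤ => v + (i : ZMod n)) '' ((Finset.Icc (-m : ℤ) m).erase 0 : Finset ℤ) := by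
  ext w
  simp only [SimpleGraph.mem_neighborSet, circ_adj h, Set.mem_image, Finset.mem_coe,
    Finset.mem_erase, Finset.mem_Icc]
  constructor
  · rintro ⟨i, h1, h2, h3 | h3⟩
    · exact ⟨i, by omega, by simp [h3]⟩
    · exact ⟨-i, by omega, by simp [h3]⟩
  · rintro ⟨i, ⟨h0, h1, h2⟩, h3⟩
    refine ⟨i.natAbs, by omega, by omega, ?_⟩
    rcases Int.natAbs_eq i with hi | hi
    · left; rw [← h3, hi]; simp
    · right; rw [← h3, hi]; simp

theorem circ_ncard_neighborSet (h : 2 * m + 3 ≤ n) (v : ZMod n) :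
    ((circ n m).neighborSet v).ncard = 2 * m := by
  rw [circ_neighborSet h, Set.InjOn.ncard_image, Set.ncard_coe_finset, Finset.card_erase_of_mem]
  · simp; omega
  · simp
  · intro a ha b hb hab
    simp only [Finset.mem_coe, Finset.mem_erase, Finset.mem_Icc] at ha hb
    refine eq_of_intCast_eq (n := n) ?_ (add_left_cancel hab)
    rw [abs_lt]
    omega

/-- Shifting by `m` moves the interval `[u - m, u + m]` to the residues `0, …, 2m`, so membership
becomes a single inequality on `val`. -/
theorem circ_eq_or_adj (h : 2 * m + 3 ≤ n) {u w : ZMod n} :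
    w = u ∨ (circ n m).Adj u w ↔ (w - u + m).val ≤ 2 * m := by
  have : NeZero n := ⟨by omega⟩
  rw [circ_adj h]
  constructor
  · rintro (rfl | ⟨i, h1, h2, rfl | rfl⟩)
    · rw [sub_self, zero_add, ZMod.val_cast_of_lt (by omega)]; omega
    · have : u + (i : ZMod n) - u + (m : ZMod n) = ((i + m : ℕ) : ZMod n) := by push_cast; ring
      rw [this, ZMod.val_cast_of_lt (by omega)]; omega
    · have : w - (w + (i : ZMod n)) + m = ((m - i : ℕ) : ZMod n) := by
        rw [Nat.cast_sub h2]; ring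
      rw [this, ZMod.val_cast_of_lt (by omega)]; omega
  · intro hc
    have hw : ((w - u + m).val : ZMod n) = w - u + m := ZMod.natCast_zmod_val _
    generalize (w - u + m).val = c at hc hw
    rcases lt_trichotomy c m with h1 | h1 | h1
    · refine Or.inr ⟨m - c, by omega, by omega, Or.inr ?_⟩
      rw [Nat.cast_sub h1.le, hw]; ring
    · subst h1
      exact Or.inl (by linear_combination -hw)
    · refine Or.inr ⟨c - m, by omega, by omega, Or.inl ?_⟩
      rw [Nat.cast_sub h1.le, hw]; ring

/-- Vertices at cyclic distance one are recognised by their closed neighbourhoods. -/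
theorem circ_consecutive_iff (hm : 1 ≤ m) (h : 2 * m + 3 ≤ n) {u v : ZMod n} (huv : u ≠ v) :
    (v = u + 1 ∨ u = v + 1) ↔
      {w | (w = u ∨ (circ n m).Adj u w) ∧ ¬(w = v ∨ (circ n m).Adj v w)}.Subsingleton := by
  have : NeZero n := ⟨by omega⟩
  simp only [circ_eq_or_adj h]
  constructor
  · have hval : ∀ w : ZMod n, ∃ c : ℕ, c < n ∧ w - u + (m : ZMod n) = (c : ZMod n) := fun w =>
      ⟨_, ZMod.val_lt _, (ZMod.natCast_zmod_val _).symm⟩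
    -- The only point that can be lost is the far end of the interval: `u - m` when `v = u + 1`, and
    -- `u + m` when `u = v + 1`.
    rintro (rfl | rfl)
    · suffices H : ∀ w : ZMod n, (w - u + m).val ≤ 2 * m ∧ ¬ (w - (u + 1) + m).val ≤ 2 * m →
          w = u - m from fun a ha b hb => (H a ha).trans (H b hb).symm
      rintro w ⟨h1, h2⟩
      obtain ⟨c, hc, hw⟩ := hval w
      rw [hw, ZMod.val_cast_of_lt hc] at h1
      rcases Nat.eq_zero_or_pos c with rfl | hpos
      · rw [Nat.cast_zero] at hw
        linear_combination hw
      · have : w - (u + 1) + m = ((c - 1 : ℕ) : ZMod n) := by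
          rw [Nat.cast_sub hpos, ← hw]; push_cast; ring
        rw [this, ZMod.val_cast_of_lt (by omega)] at h2
        omega
    · suffices H : ∀ w : ZMod n, (w - (v + 1) + m).val ≤ 2 * m ∧ ¬ (w - v + m).val ≤ 2 * m →
          w = v + 1 + m from fun a ha b hb => (H a ha).trans (H b hb).symm
      rintro w ⟨h1, h2⟩
      obtain ⟨c, hc, hw⟩ := hval w
      rw [hw, ZMod.val_cast_of_lt hc] at h1
      rcases h1.eq_or_lt with rfl | hlt
      · push_cast at hw
        linear_combination hw
      · have : w - v + m = ((c + 1 : ℕ) : ZMod n) := by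
          push_cast; rw [← hw]; ring
        rw [this, ZMod.val_cast_of_lt (by omega)] at h2
        omega
  · intro hs
    by_contra hcon
    push Not at hcon
    obtain ⟨d, hd, hv⟩ : ∃ d : ℕ, d < n ∧ v - u = d :=
      ⟨_, ZMod.val_lt (v - u), (ZMod.natCast_zmod_val _).symm⟩
    obtain rfl : v = u + d := by rw [← hv]; ring
    have hn : (n : ZMod n) = 0 := ZMod.natCast_self n
    have hd0 : d ≠ 0 := by rintro rfl; simp at huv
    have hd1 : d ≠ 1 := by rintro rfl; simp at hcon
    have hd2 : d ≠ n - 1 := by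
      rintro rfl
      apply hcon.2
      rw [Nat.cast_sub (by omega), hn]; push_cast; ring
    -- Here `a` and `b` are the offsets of one point from the left ends of the intervals around `u`
    -- and `u + d`.
    have key : ∀ a b : ℕ, a ≤ 2 * m → 2 * m < b → b < n → (a : ZMod n) - d = b →
        u - m + (a : ZMod n) ∈ {w : ZMod n | (w - u + m).val ≤ 2 * m ∧
          ¬ (w - (u + d) + m).val ≤ 2 * m} := by
      intro a b ha hb hbn hab
      have e1 : u - m + (a : ZMod n) - u + m = a := by ring
      have e2 : u - m + (a : ZMod n) - (u + d) + m = b := by rw [← hab]; ring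
      rw [Set.mem_ofPred_eq, e1, e2, ZMod.val_cast_of_lt (by omega), ZMod.val_cast_of_lt hbn]
      omega
    have fin : ∀ a b : ℕ, a + 1 ≤ 2 * m → 2 * m < b → b + 1 < n → (a : ZMod n) - d = b →
        False := by
      intro a b ha hb hbn hab
      have := hs (key a b (by omega) hb (by omega) hab)
        (key (a + 1) (b + 1) ha (by omega) hbn (by push_cast; rw [← hab]; ring))
      rw [add_right_inj] at this
      have h2 := congrArg ZMod.val this
      rw [ZMod.val_cast_of_lt (by omega), ZMod.val_cast_of_lt (by omega)] at h2
      omega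
    -- For small `d` the two witnesses lie just to the left of the interval around `u + d`, where `n
    -- - 2 > 2m` is needed. For large `d` they are the last two points of the interval around `u`.
    rcases le_or_gt d (2 * m + 1) with hle | hgt
    · refine fin (d - 2) (n - 2) (by omega) (by omega) (by omega) ?_
      rw [Nat.cast_sub (by omega), Nat.cast_sub (by omega), hn]; ring
    · refine fin (2 * m - 1) (2 * m - 1 + n - d) (by omega) (by omega) (by omega) ?_
      rw [Nat.cast_sub (by omega : d ≤ 2 * m - 1 + n), Nat.cast_add, hn]; ring

theorem circ_iso_consecutive (hm : 1 ≤ m) (h : 2 * m + 3 ≤ n) (α : circ n m ≃g circ n m)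
    (u : ZMod n) : α (u + 1) = α u + 1 ∨ α u = α (u + 1) + 1 := by
  have hne : u ≠ u + 1 := (circ_adj_add_one hm h u).ne
  rw [circ_consecutive_iff hm h (α.injective.ne hne)]
  have hs := (circ_consecutive_iff hm h hne).1 (Or.inl rfl)
  intro a ha b hb
  apply α.symm.injective
  obtain ⟨a, rfl⟩ := α.surjective a
  obtain ⟨b, rfl⟩ := α.surjective b
  simp only [Set.mem_ofPred_eq, α.map_adj_iff, α.injective.eq_iff] at ha hb
  rw [hs ha hb]

theorem circ_two_ne_zero (h : 2 * m + 3 ≤ n) : (2 : ZMod n) ≠ 0 := by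
  intro h0
  have : ((2 : ℕ) : ZMod n) = 0 := by exact_mod_cast h0
  rw [ZMod.natCast_eq_zero_iff] at this
  have := Nat.le_of_dvd (by omega) this
  omega

/-- Each step `α (u + 1) - α u` is `±1`. Two successive steps cannot cancel, since `α` is injective
and `2 ≠ 0`, so all steps are equal. -/
theorem circ_iso_affine (hm : 1 ≤ m) (h : 2 * m + 3 ≤ n) (α : circ n m ≃g circ n m) :
    ∃ ε : ZMod n, (ε = 1 ∨ ε = -1) ∧ ∀ x, α x = ε * x + α 0 := by
  have : NeZero n := ⟨by omega⟩
  have hstep : ∀ u, α (u + 1) - α u = 1 ∨ α (u + 1) - α u = -1 := fun u => by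
    rcases circ_iso_consecutive hm h α u with h1 | h1
    · left; rw [h1]; ring
    · right; linear_combination -h1
  have hconst : ∀ u, α (u + 1 + 1) - α (u + 1) = α (u + 1) - α u := by
    intro u
    have hne : α (u + 1 + 1) - α u ≠ 0 := by
      rw [sub_ne_zero, α.injective.ne_iff]
      intro h0
      exact circ_two_ne_zero h (by linear_combination h0)
    rcases hstep u with h1 | h1 <;> rcases hstep (u + 1) with h2 | h2
    · rw [h1, h2]
    · exact absurd (by linear_combination h1 + h2) hne
    · exact absurd (by linear_combination h1 + h2) hne
    · rw [h1, h2]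
  have hall : ∀ k : ℕ, α ((k : ZMod n) + 1) - α k = α 1 - α 0 := by
    intro k
    induction k with
    | zero => simp
    | succ k ih => push_cast; rw [hconst, ih]
  refine ⟨α 1 - α 0, by simpa using hstep 0, fun x => ?_⟩
  have hnat : ∀ k : ℕ, α k = (α 1 - α 0) * k + α 0 := by
    intro k
    induction k with
    | zero => simp
    | succ k ih =>
      push_cast
      linear_combination hall k + ih
  simpa using hnat x.val

/-- The affine maps `x ↦ ε x + c` with `ε = ±1` are automorphisms of the circulant graph. -/
def circAffine (h : 2 * m + 3 ≤ n) (ε : ℤˣ) (c : ZMod n) : circ n m ≃g circ n m where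
  toFun x := (ε : ℤ) * x + c
  invFun x := (ε : ℤ) * (x - c)
  left_inv x := by rcases Int.units_eq_one_or ε with rfl | rfl <;> simp
  right_inv x := by rcases Int.units_eq_one_or ε with rfl | rfl <;> simp
  map_rel_iff' := by
    intro u v
    rw [circ_adj h, circ_adj h]
    refine exists_congr fun i => and_congr_right fun _ => and_congr_right fun _ => ?_
    rcases Int.units_eq_one_or ε with rfl | rfl
    · refine or_congr ⟨fun h => ?_, fun h => ?_⟩ ⟨fun h => ?_, fun h => ?_⟩ <;> simp at h ⊢ <;>
        linear_combination h
    · rw [or_comm]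
      refine or_congr ⟨fun h => ?_, fun h => ?_⟩ ⟨fun h => ?_, fun h => ?_⟩ <;> simp at h ⊢ <;>
        linear_combination h

@[simp]
theorem circAffine_apply (h : 2 * m + 3 ≤ n) (ε : ℤˣ) (c x : ZMod n) :
    circAffine h ε c x = (ε : ℤ) * x + c := rfl

/-- The dihedral group acting on the circulant graph. -/
def dihedralToAut (h : 2 * m + 3 ≤ n) : DihedralGroup n →* (circ n m ≃g circ n m) where
  toFun
    | .r i => circAffine h 1 i
    -- The translation is by `-i` to agree with the convention `sr i * sr j = r (j - i)`.
    | .sr i => circAffine h (-1) (-i)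
  map_one' := by
    rw [DihedralGroup.one_def]
    ext x
    simp
  map_mul' := by
    rintro (i | i) (j | j)
    all_goals
      simp only [DihedralGroup.r_mul_r, DihedralGroup.r_mul_sr, DihedralGroup.sr_mul_r,
        DihedralGroup.sr_mul_sr]
      ext x
      simp only [RelIso.coe_mul, Function.comp_apply, circAffine_apply]
      push_cast
      ring

/-- Values at `0` and `1` separate the group elements: a rotation and a reflection agreeing at both
would give `2 = 0`. Surjectivity is `circ_iso_affine`. -/
theorem dihedralToAut_bijective (hm : 1 ≤ m) (h : 2 * m + 3 ≤ n) :
    Function.Bijective (dihedralToAut h) := by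
  have h2 := circ_two_ne_zero h
  have hr : ∀ i x, dihedralToAut h (.r i) x = x + i := fun i x => by simp [dihedralToAut]
  have hsr : ∀ i x, dihedralToAut h (.sr i) x = -x - i := fun i x => by
    simp [dihedralToAut, sub_eq_add_neg]
  constructor
  · rintro (i | i) (j | j) hij
    all_goals
      have e0 := congrArg (fun f : circ n m ≃g circ n m => f 0) hij
      have e1 := congrArg (fun f : circ n m ≃g circ n m => f 1) hij
      simp only [hr, hsr] at e0 e1
    · rw [show i = j by linear_combination e0]
    · exact absurd (by linear_combination e1 - e0) h2
    · exact absurd (by linear_combination e0 - e1) h2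
    · rw [show i = j by linear_combination -e0]
  · intro α
    obtain ⟨ε, rfl | rfl, hα⟩ := circ_iso_affine hm h α
    · exact ⟨.r (α 0), by ext x; rw [hr, hα x]; ring⟩
    · exact ⟨.sr (-α 0), by ext x; rw [hsr, hα x]; ring⟩

end Circulant

/-! ### Nut kernels and the maximum principle -/

section Kernel

open Classical in
/-- The vectors in the kernel of the adjacency matrix, described entrywise. -/
def InKernel {V : Type*} [Fintype V] (G : SimpleGraph V) (x : V → ℝ) : Prop :=
  ∀ v, ∑ u, (if G.Adj v u then x u else 0) = 0

/-- The kernel of the adjacency matrix is spanned by a vector without zero entries. -/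
def HasNutKernel {V : Type*} [Fintype V] (G : SimpleGraph V) : Prop :=
  ∃ z : V → ℝ, (∀ v, z v ≠ 0) ∧ ∀ x, InKernel G x ↔ ∃ c : ℝ, x = c • z

theorem HasNutKernel.isNut {V : Type*} [Fintype V] [Nonempty V] {G : SimpleGraph V}
    (h : HasNutKernel G) : IsNut G := by
  let := Classical.decRel G.Adj
  obtain ⟨z, hz, hker⟩ := h
  have hmem : ∀ x, x ∈ LinearMap.ker (G.adjMatrix ℝ).mulVecLin ↔ ∃ c : ℝ, x = c • z := by
    intro x
    rw [← hker, LinearMap.mem_ker, Matrix.mulVecLin_apply, funext_iff]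
    refine forall_congr' fun v => ?_
    simp only [Matrix.mulVec, dotProduct, SimpleGraph.adjMatrix_apply, ite_mul, one_mul, zero_mul,
      Pi.zero_apply]
  have hspan : LinearMap.ker (G.adjMatrix ℝ).mulVecLin = Submodule.span ℝ {z} := by
    ext x
    rw [hmem, Submodule.mem_span_singleton]
    exact exists_congr fun c => eq_comm
  have hz0 : z ≠ 0 := fun h0 => hz (Classical.arbitrary V) (by rw [h0]; rfl)
  refine ⟨?_, fun x hx hx0 v => ?_⟩
  · change Module.finrank ℝ (LinearMap.ker (G.adjMatrix ℝ).mulVecLin) = 1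
    rw [hspan, finrank_span_singleton hz0]
  · obtain ⟨c, rfl⟩ := (hmem x).1 hx
    refine mul_ne_zero ?_ (hz v)
    rintro rfl
    exact hx0 (zero_smul _ _)

theorem HasNutKernel.of_iso {V W : Type*} [Fintype V] [Fintype W] {G : SimpleGraph V}
    {H : SimpleGraph W} (e : G ≃g H) (h : HasNutKernel H) : HasNutKernel G := by
  classical
  obtain ⟨z, hz, hker⟩ := h
  refine ⟨z ∘ e, fun v => hz _, fun x => ?_⟩
  have h1 : InKernel G x ↔ InKernel H (x ∘ e.symm) := by
    unfold InKernel
    rw [← e.toEquiv.forall_congr_right]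
    refine forall_congr' fun v => ?_
    rw [← e.toEquiv.sum_comp]
    simp [SimpleGraph.Iso.map_adj_iff]
  rw [h1, hker]
  refine exists_congr fun c => ⟨fun h => ?_, fun h => ?_⟩
  · funext v
    simpa using congrFun h (e v)
  · funext w
    simp [h]

open Classical in
-- Maximum principle: at a vertex attaining the maximum, the nonnegative differences to its
-- neighbours sum to zero, so the maximum spreads along walks.
theorem eq_of_harmonic {V : Type*} [Fintype V] {G : SimpleGraph V} (hG : G.Preconnected) {d : ℕ}
    (hd : ∀ v, (G.neighborSet v).ncard = d) {x : V → ℝ}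
    (hx : ∀ v, ∑ u, (if G.Adj v u then x u else 0) = d * x v) (u v : V) : x u = x v := by
  have : Nonempty V := ⟨u⟩
  obtain ⟨a, ha⟩ := Finite.exists_max x
  have hcard : ∀ v, ∑ u, (if G.Adj v u then (1 : ℝ) else 0) = d := by
    intro v
    rw [Finset.sum_boole, ← hd v, Set.ncard_eq_toFinset_card']
    congr 2
    ext w
    simp
  have hstep : ∀ v w, G.Adj v w → x v = x a → x w = x a := by
    intro v w hvw hv
    have h0 : ∑ u, (if G.Adj v u then x a - x u else 0) = 0 := by
      have : ∀ u, (if G.Adj v u then x a - x u else 0) =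
          (if G.Adj v u then (1 : ℝ) else 0) * x a - (if G.Adj v u then x u else 0) := by
        intro u; split_ifs <;> simp
      rw [Finset.sum_congr rfl fun u _ => this u, Finset.sum_sub_distrib, ← Finset.sum_mul,
        hcard, hx, hv, sub_self]
    rw [Finset.sum_eq_zero_iff_of_nonneg] at h0
    · have := h0 w (Finset.mem_univ _)
      rw [if_pos hvw] at this
      linarith
    · intro u _
      split_ifs
      · linarith [ha u]
      · exact le_rfl
  have hall : ∀ w, x w = x a := by
    intro w
    obtain ⟨p⟩ := hG w a
    -- The walk ends at `a`, so the induction varies `a`; naming the maximum keeps `hstep`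
    -- independent of it.
    generalize hM : x a = M at hstep
    induction p with
    | nil => exact hM
    | cons hadj _ ih => exact hstep _ _ hadj.symm (ih ha hM)
  rw [hall u, hall v]

end Kernel

/-! ### The kernel of a multiplier graph -/

section Multiplier

variable {V : Type*} {G : SimpleGraph V} {t k : ℕ}

/-- The closed walk `v, (v, j, 0), …, (v, j, k - 2), v` around the `j`-th cycle fused at `v`. -/
def cycleVertex (k : ℕ) (v : V) (j : Fin t) : ℕ → V ⊕ V × Fin t × Fin (k - 1)
  | 0 => .inl v
  | i + 1 => if h : i < k - 1 then .inr (v, j, ⟨i, h⟩) else .inl v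

@[simp]
theorem cycleVertex_zero (v : V) (j : Fin t) : cycleVertex k v j 0 = .inl v := rfl

theorem cycleVertex_succ (v : V) (j : Fin t) {i : ℕ} (h : i < k - 1) :
    cycleVertex k v j (i + 1) = .inr (v, j, ⟨i, h⟩) := dif_pos h

theorem cycleVertex_of_le (v : V) (j : Fin t) {i : ℕ} (h : k ≤ i) :
    cycleVertex k v j i = .inl v := by
  rcases i with _ | i
  · rfl
  · exact dif_neg (by omega)

/-- The vertex `(v, j, i)` sits at position `i + 1` of the closed walk. Both ends of the walk being
`v`, no case distinction is needed at the ends. -/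
theorem multiplier_adj_inr_iff (v : V) (j : Fin t) (i : Fin (k - 1))
    (w : V ⊕ V × Fin t × Fin (k - 1)) :
    (multiplier G t k).Adj (.inr (v, j, i)) w ↔
      w = cycleVertex k v j i ∨ w = cycleVertex k v j (i + 2) := by
  obtain ⟨i, hi⟩ := i
  rcases w with u | ⟨u, j', i', hi'⟩
  · change u = v ∧ (i = 0 ∨ i + 2 = k) ↔ _
    rcases i with _ | i <;> simp only [cycleVertex] <;> split_ifs <;> simp <;> omega
  · change v = u ∧ j = j' ∧ (i + 1 = i' ∨ i' + 1 = i) ↔ _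
    rcases i with _ | i <;> simp only [cycleVertex] <;> split_ifs <;> simp <;> grind

theorem cycleVertex_ne (hk : 3 ≤ k) (v : V) (j : Fin t) {i : ℕ} (hi : i < k - 1) :
    cycleVertex k v j i ≠ cycleVertex k v j (i + 2) := by
  rcases i with _ | i <;> simp only [cycleVertex] <;> split_ifs <;> simp <;> omega

open Classical in
theorem sum_multiplier_inr [Fintype V] (hk : 3 ≤ k) (v : V) (j : Fin t) (i : Fin (k - 1))
    (x : V ⊕ V × Fin t × Fin (k - 1) → ℝ) :
    ∑ w, (if (multiplier G t k).Adj (.inr (v, j, i)) w then x w else 0) =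
      x (cycleVertex k v j i) + x (cycleVertex k v j (i + 2)) := by
  rw [← Finset.sum_filter, ← Finset.sum_pair (cycleVertex_ne hk v j i.2)]
  congr 1
  ext w
  simp [multiplier_adj_inr_iff]

open Classical in
theorem sum_multiplier_inl [Fintype V] (hk : 3 ≤ k) (v : V)
    (x : V ⊕ V × Fin t × Fin (k - 1) → ℝ) :
    ∑ w, (if (multiplier G t k).Adj (.inl v) w then x w else 0) =
      ∑ u, (if G.Adj v u then x (.inl u) else 0) +
        ∑ j, (x (cycleVertex k v j 1) + x (cycleVertex k v j (k - 1))) := by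
  rw [Fintype.sum_sum_type]
  congr 1
  rw [Fintype.sum_prod_type, Finset.sum_eq_single v, Fintype.sum_prod_type]
  · refine Finset.sum_congr rfl fun j _ => ?_
    have h0 : 0 < k - 1 := by omega
    have h1 : k - 2 < k - 1 := by omega
    have e1 : cycleVertex k v j 1 = .inr (v, j, ⟨0, h0⟩) := cycleVertex_succ v j h0
    have e2 : cycleVertex k v j (k - 1) = .inr (v, j, ⟨k - 2, h1⟩) := by
      rw [← cycleVertex_succ v j h1]; congr 1; omega
    rw [e1, e2, ← Finset.sum_pair (f := fun i => x (.inr (v, j, i))) (by simp; omega),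
      ← Finset.sum_filter]
    congr 1
    ext i
    rw [Finset.mem_filter, Finset.mem_insert, Finset.mem_singleton, Fin.ext_iff, Fin.ext_iff]
    change _ ∧ v = v ∧ (i.val = 0 ∨ i.val + 2 = k) ↔ _
    simp
    omega
  · intro u _ hu
    refine Finset.sum_eq_zero fun p _ => if_neg fun h => hu ?_
    exact (show v = u ∧ _ from h).1.symm
  · simp

/-- The sign pattern `+, -, -, +, +, -, -, …`. -/
def kernelSign (i : ℕ) : ℝ := (-1) ^ ((i + 1) / 2)

theorem kernelSign_add_two (i : ℕ) : kernelSign (i + 2) = -kernelSign i := by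
  rw [kernelSign, kernelSign, show (i + 2 + 1) / 2 = (i + 1) / 2 + 1 by omega, pow_succ]
  ring

theorem kernelSign_zero : kernelSign 0 = 1 := by norm_num [kernelSign]

theorem kernelSign_one : kernelSign 1 = -1 := by norm_num [kernelSign]

theorem kernelSign_two_mul (a : ℕ) : kernelSign (2 * a) = (-1) ^ a := by
  rw [kernelSign]; congr 1; omega

theorem kernelSign_two_mul_add_one (a : ℕ) : kernelSign (2 * a + 1) = -(-1) ^ a := by
  rw [kernelSign, show (2 * a + 1 + 1) / 2 = a + 1 by omega, pow_succ]; ring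

theorem kernelSign_four_mul_sub_one {q : ℕ} (hq : 1 ≤ q) : kernelSign (4 * q - 1) = 1 := by
  rw [kernelSign, show (4 * q - 1 + 1) / 2 = 2 * q by omega, pow_mul]; norm_num

theorem kernelSign_four_mul_sub_two {q : ℕ} (hq : 1 ≤ q) : kernelSign (4 * q - 1 - 1) = -1 := by
  rw [kernelSign, show (4 * q - 1 - 1 + 1) / 2 = 2 * (q - 1) + 1 by omega, pow_succ, pow_mul]; norm_num

/-- The recurrence determines even positions from `y 0` and odd ones from `y 1`. The closing
position `4q - 1` is odd and links the two parities. -/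
theorem eq_kernelSign_mul {q : ℕ} (hq : 1 ≤ q) {y : ℕ → ℝ} (hend : y (4 * q - 1) = y 0)
    (hy : ∀ i < 4 * q - 2, y i + y (i + 2) = 0) {i : ℕ} (hi : i ≤ 4 * q - 1) :
    y i = kernelSign i * y 0 := by
  have heven : ∀ a, 2 * a ≤ 4 * q - 1 → y (2 * a) = (-1) ^ a * y 0 := by
    intro a
    induction a with
    | zero => simp
    | succ a ih =>
      intro ha
      have h1 := hy (2 * a) (by omega)
      rw [ih (by omega)] at h1
      rw [pow_succ, mul_add_one]
      linarith
  have hodd : ∀ a, 2 * a + 1 ≤ 4 * q - 1 → y (2 * a + 1) = (-1) ^ a * y 1 := by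
    intro a
    induction a with
    | zero => simp
    | succ a ih =>
      intro ha
      have h1 := hy (2 * a + 1) (by omega)
      rw [ih (by omega)] at h1
      rw [pow_succ, mul_add_one, add_right_comm (2 * a)]
      linarith
  have h1 : y 1 = -y 0 := by
    -- Position `4q - 1` is reached from `1` in `2q - 1` sign changes, an odd number; hence `y 0 =
    -- -y 1`.
    have h2 := hodd (2 * (q - 1) + 1) (by omega)
    rw [show 2 * (2 * (q - 1) + 1) + 1 = 4 * q - 1 by omega, hend, pow_succ, pow_mul] at h2
    norm_num at h2
    linarith
  rcases Nat.even_or_odd' i with ⟨a, rfl | rfl⟩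
  · rw [heven a hi, kernelSign_two_mul]
  · rw [hodd a hi, h1, kernelSign_two_mul_add_one]; ring

theorem hasNutKernel_multiplier [Fintype V] {q : ℕ} (hq : 1 ≤ q) (hG : G.Preconnected)
    (hd : ∀ v, (G.neighborSet v).ncard = 2 * t) : HasNutKernel (multiplier G t (4 * q - 1)) := by
  classical
  have hk : 3 ≤ 4 * q - 1 := by omega
  let z : V ⊕ V × Fin t × Fin (4 * q - 1 - 1) → ℝ :=
    Sum.elim (fun _ => 1) fun p => kernelSign (p.2.2 + 1)
  have hz : ∀ v j i, i ≤ 4 * q - 1 → z (cycleVertex (4 * q - 1) v j i) = kernelSign i := by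
    intro v j i hi
    rcases i with _ | i
    · exact kernelSign_zero.symm
    · by_cases h : i < 4 * q - 1 - 1
      · rw [cycleVertex_succ v j h]; rfl
      -- The walk has returned to `v`; the pattern closes up because `kernelSign (4 * q - 1) = 1`.
      · obtain rfl : i = 4 * q - 1 - 1 := by omega
        rw [cycleVertex_of_le v j (by omega), show 4 * q - 1 - 1 + 1 = 4 * q - 1 by omega,
          kernelSign_four_mul_sub_one hq]
        rfl
  refine ⟨z, ?_, fun x => ⟨fun hx => ?_, ?_⟩⟩
  · rintro (v | p)
    · exact one_ne_zero
    · exact pow_ne_zero _ (by norm_num)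
  · have hy : ∀ v j i, i ≤ 4 * q - 1 →
        x (cycleVertex (4 * q - 1) v j i) = kernelSign i * x (.inl v) := by
      intro v j i hi
      refine eq_kernelSign_mul (y := fun i => x (cycleVertex (4 * q - 1) v j i)) hq ?_ ?_ hi
      · simp only [cycleVertex_zero, cycleVertex_of_le v j le_rfl]
      · intro i hi
        have := hx (.inr (v, j, ⟨i, by omega⟩))
        rwa [sum_multiplier_inr hk] at this
    -- Each cycle contributes `-2 * x v` at its base vertex, so the `t` cycles balance exactly the
    -- degree `2t`.
    have hharm : ∀ v, ∑ u, (if G.Adj v u then x (.inl u) else 0) =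
        ((2 * t : ℕ) : ℝ) * x (.inl v) := by
      intro v
      have h1 := hx (.inl v)
      rw [sum_multiplier_inl hk] at h1
      have h2 : ∀ j : Fin t, x (cycleVertex (4 * q - 1) v j 1) +
          x (cycleVertex (4 * q - 1) v j (4 * q - 1 - 1)) = -2 * x (.inl v) := by
        intro j
        rw [hy v j 1 (by omega), hy v j _ (by omega), kernelSign_one,
          kernelSign_four_mul_sub_two hq]
        ring
      rw [Finset.sum_congr rfl fun j _ => h2 j, Finset.sum_const, Finset.card_univ,
        Fintype.card_fin, nsmul_eq_mul] at h1
      push_cast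
      linarith
    have hconst := eq_of_harmonic hG hd hharm
    rcases isEmpty_or_nonempty V with hV | ⟨⟨v₀⟩⟩
    · exact ⟨0, funext fun w => hV.elim (Sum.elim id (fun p => p.1) w)⟩
    · refine ⟨x (.inl v₀), funext ?_⟩
      rintro (v | ⟨v, j, i, hi⟩)
      · simpa [z] using hconst v v₀
      · have := hy v j (i + 1) (by omega)
        rw [cycleVertex_succ v j hi, hconst v v₀] at this
        rw [this, Pi.smul_apply, smul_eq_mul, mul_comm]
        rfl
  · rintro ⟨c, rfl⟩ (v | ⟨v, j, i⟩)
    · rw [sum_multiplier_inl hk]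
      have h2 : ∀ j : Fin t, (c • z) (cycleVertex (4 * q - 1) v j 1) +
          (c • z) (cycleVertex (4 * q - 1) v j (4 * q - 1 - 1)) = -2 * c := by
        intro j
        rw [Pi.smul_apply, Pi.smul_apply, hz v j 1 (by omega), hz v j _ (by omega), kernelSign_one,
          kernelSign_four_mul_sub_two hq, smul_eq_mul]
        ring
      have h3 : ∑ u, (if G.Adj v u then (c • z) (.inl u) else 0) = 2 * t * c := by
        have : ∀ u, (if G.Adj v u then (c • z) (.inl u) else 0) = if G.Adj v u then c else 0 := by
          intro u; simp [z]
        rw [Finset.sum_congr rfl fun u _ => this u, ← Finset.sum_filter, Finset.sum_const,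
          nsmul_eq_mul]
        have hcard := hd v
        rw [Set.ncard_eq_toFinset_card'] at hcard
        have : ({u | G.Adj v u} : Finset V).card = 2 * t := by
          rw [← hcard]; congr 1; ext w; simp
        rw [this]
        push_cast
        ring
      rw [h3, Finset.sum_congr rfl fun j _ => h2 j, Finset.sum_const, Finset.card_univ,
        Fintype.card_fin, nsmul_eq_mul]
      ring
    · rw [sum_multiplier_inr hk, Pi.smul_apply, Pi.smul_apply, hz _ _ _ (by omega),
        hz _ _ _ (by omega), kernelSign_add_two]
      simp

end Multiplier

/-! ### Counting orbits and isomorphism invariance -/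

section Orbits

/-- Orbits are counted through a complete numerical invariant: `depth` for vertices, `edgeIndex` for
edges. -/
theorem card_quotient_eq {X : Type*} (s : Setoid X) (f : X → ℕ) (c : ℕ)
    (h1 : ∀ x y, s x y → f x = f y) (h2 : ∀ x y, f x = f y → s x y) (h3 : ∀ x, f x < c)
    (h4 : ∀ i < c, ∃ x, f x = i) : Nat.card (Quotient s) = c := by
  let g : Quotient s → Fin c := Quotient.lift (fun x => ⟨f x, h3 x⟩) fun x y h =>
    Fin.ext (h1 x y h)
  have hg : Function.Bijective g := by
    constructor
    · rintro ⟨x⟩ ⟨y⟩ hxy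
      exact Quotient.sound (h2 x y (Fin.ext_iff.1 hxy))
    · rintro ⟨i, hi⟩
      obtain ⟨x, rfl⟩ := h4 i hi
      exact ⟨Quotient.mk s x, rfl⟩
  rw [Nat.card_congr (Equiv.ofBijective g hg), Nat.card_fin]

theorem numVertexOrbits_congr {V W : Type*} {G : SimpleGraph V} {H : SimpleGraph W} (e : G ≃g H) :
    numVertexOrbits G = numVertexOrbits H := by
  refine Nat.card_congr (Quotient.congr e.toEquiv fun u v => ⟨?_, ?_⟩)
  · rintro ⟨α, h⟩
    exact ⟨(e.symm.trans α).trans e, by simp [h]⟩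
  · rintro ⟨α, h⟩
    exact ⟨(e.trans α).trans e.symm, by simpa using congrArg e.symm h⟩

theorem numEdgeOrbits_congr {V W : Type*} {G : SimpleGraph V} {H : SimpleGraph W} (e : G ≃g H) :
    numEdgeOrbits G = numEdgeOrbits H := by
  refine Nat.card_congr (Quotient.congr e.mapEdgeSet fun x y => ⟨?_, ?_⟩)
  · rintro ⟨α, h⟩
    refine ⟨(e.symm.trans α).trans e, ?_⟩
    change Sym2.map (e ∘ α ∘ e.symm) (Sym2.map e x.1) = Sym2.map e y.1
    rw [← h, Sym2.map_map, Sym2.map_map]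
    congr 1
    ext v
    simp
  · rintro ⟨α, h⟩
    refine ⟨(e.trans α).trans e.symm, ?_⟩
    change Sym2.map α (Sym2.map e x.1) = Sym2.map e y.1 at h
    apply Sym2.map.injective e.injective
    rw [← h, Sym2.map_map, Sym2.map_map]
    congr 1
    ext v
    simp

end Orbits

/-! ### Automorphisms and vertex orbits of multiplier graphs -/

section MultiplierAut

variable {V : Type*} {G : SimpleGraph V} {t k : ℕ}

/-- The distance of a vertex of the multiplier graph to the original graph. -/
def depth : V ⊕ V × Fin t × Fin (k - 1) → ℕ
  | .inl _ => 0
  | .inr (_, _, i) => 1 + min i.val (k - 2 - i.val)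

@[simp]
theorem depth_inl (v : V) : depth (.inl v : V ⊕ V × Fin t × Fin (k - 1)) = 0 := rfl

theorem depth_inr (v : V) (j : Fin t) (i : Fin (k - 1)) :
    depth (.inr (v, j, i) : V ⊕ V × Fin t × Fin (k - 1)) = 1 + min i.val (k - 2 - i.val) := rfl

theorem depth_cycleVertex (v : V) (j : Fin t) (i : ℕ) :
    depth (cycleVertex k v j i) = min i (k - i) := by
  rcases i with _ | i
  · simp
  · by_cases h : i < k - 1
    · rw [cycleVertex_succ v j h, depth_inr]; simp only; omega
    · rw [cycleVertex_of_le v j (by omega), depth_inl]; omega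

theorem inr_eq_cycleVertex (v : V) (j : Fin t) (i : Fin (k - 1)) :
    .inr (v, j, i) = cycleVertex k v j (i + 1) := (cycleVertex_succ v j i.2).symm

theorem cycleVertex_adj (v : V) (j : Fin t) (hk : 3 ≤ k) {i : ℕ} (hi : i < k) :
    (multiplier G t k).Adj (cycleVertex k v j i) (cycleVertex k v j (i + 1)) := by
  by_cases h : i < k - 1
  · refine SimpleGraph.Adj.symm ?_
    rw [cycleVertex_succ v j h, multiplier_adj_inr_iff]
    exact Or.inl rfl
  · obtain ⟨i, rfl⟩ : ∃ i', i = i' + 1 := ⟨i - 1, by omega⟩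
    rw [cycleVertex_succ v j (by omega : i < k - 1), multiplier_adj_inr_iff]
    exact Or.inr rfl

/-- Expresses each sublevel set of `depth` through the previous one and adjacency, so that
invariance only has to be checked at depth zero. -/
theorem depth_le_succ_iff (x : V ⊕ V × Fin t × Fin (k - 1)) (d : ℕ) :
    depth x ≤ d + 1 ↔ ∃ y, (y = x ∨ (multiplier G t k).Adj x y) ∧ depth y ≤ d := by
  rcases x with v | ⟨v, j, i⟩
  · simp only [depth_inl, zero_le, true_iff]
    exact ⟨.inl v, Or.inl rfl, Nat.zero_le _⟩
  · have hi := i.2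
    simp only [multiplier_adj_inr_iff]
    constructor
    · intro h
      rw [depth_inr] at h
      by_cases hle : i.val ≤ k - 2 - i.val
      · exact ⟨_, Or.inr (Or.inl rfl), by rw [depth_cycleVertex]; omega⟩
      · exact ⟨_, Or.inr (Or.inr rfl), by rw [depth_cycleVertex]; omega⟩
    · rintro ⟨y, rfl | rfl | rfl, h⟩
      · omega
      · rw [depth_cycleVertex] at h; rw [depth_inr]; omega
      · rw [depth_cycleVertex] at h; rw [depth_inr]; omega

theorem depth_eq_zero_iff {x : V ⊕ V × Fin t × Fin (k - 1)} :
    depth x = 0 ↔ ∃ v, x = .inl v := by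
  rcases x with v | ⟨v, j, i⟩
  · simp
  · simp [depth_inr]

/-- A base vertex has a neighbour in `G` and the two ends of an attached cycle, distinct as `k ≥ 3`;
any other vertex has only its two walk neighbours. -/
theorem depth_eq_zero_iff_three_neighbors (hk : 3 ≤ k) (ht : 1 ≤ t) (hG : ∀ v, ∃ u, G.Adj v u)
    {x : V ⊕ V × Fin t × Fin (k - 1)} :
    depth x = 0 ↔ ∃ a b c, (a ≠ b ∧ a ≠ c ∧ b ≠ c) ∧ (multiplier G t k).Adj x a ∧
      (multiplier G t k).Adj x b ∧ (multiplier G t k).Adj x c := by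
  rcases x with v | ⟨v, j, i⟩
  · simp only [depth_inl, true_iff]
    obtain ⟨u, hu⟩ := hG v
    refine ⟨.inl u, .inr (v, ⟨0, ht⟩, ⟨0, by omega⟩), .inr (v, ⟨0, ht⟩, ⟨k - 2, by omega⟩),
      ⟨by simp, by simp, ?_⟩, hu, ⟨rfl, Or.inl rfl⟩, ⟨rfl, Or.inr ?_⟩⟩
    · simp; omega
    · simp only; omega
  · simp only [multiplier_adj_inr_iff, depth_inr]
    constructor
    · omega
    · rintro ⟨a, b, c, ⟨h1, h2, h3⟩, ha | ha, hb | hb, hc | hc⟩ <;> simp_all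

theorem depth_iso (hk : 3 ≤ k) (ht : 1 ≤ t) (hG : ∀ v, ∃ u, G.Adj v u)
    (α : multiplier G t k ≃g multiplier G t k) (x : V ⊕ V × Fin t × Fin (k - 1)) :
    depth (α x) = depth x := by
  have hzero : ∀ (α : multiplier G t k ≃g multiplier G t k) x, depth x = 0 → depth (α x) = 0 := by
    intro α x hx
    obtain ⟨a, b, c, ⟨h1, h2, h3⟩, h4, h5, h6⟩ :=
      (depth_eq_zero_iff_three_neighbors hk ht hG).1 hx
    exact (depth_eq_zero_iff_three_neighbors hk ht hG).2 ⟨α a, α b, α c,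
      ⟨α.injective.ne h1, α.injective.ne h2, α.injective.ne h3⟩,
      α.map_adj_iff.2 h4, α.map_adj_iff.2 h5, α.map_adj_iff.2 h6⟩
  have key : ∀ d x, depth (α x) ≤ d ↔ depth x ≤ d := by
    intro d
    induction d with
    | zero =>
      intro x
      rw [Nat.le_zero, Nat.le_zero]
      exact ⟨fun h => by simpa using hzero α.symm _ h, hzero α x⟩
    | succ d ih =>
      intro x
      rw [depth_le_succ_iff (G := G), depth_le_succ_iff (G := G), ← α.toEquiv.exists_congr_right]
      refine exists_congr fun y => ?_
      change (α y = α x ∨ (multiplier G t k).Adj (α x) (α y)) ∧ depth (α y) ≤ d ↔ _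
      rw [ih, α.injective.eq_iff, α.map_adj_iff]
  exact le_antisymm ((key _ x).2 le_rfl) ((key _ x).1 le_rfl)

/-- An automorphism of the multiplier graph restricts to an automorphism of the original graph. -/
theorem exists_base_iso (hk : 3 ≤ k) (ht : 1 ≤ t) (hG : ∀ v, ∃ u, G.Adj v u)
    (α : multiplier G t k ≃g multiplier G t k) :
    ∃ β : G ≃g G, ∀ v, α (.inl v) = .inl (β v) := by
  have h : ∀ (α : multiplier G t k ≃g multiplier G t k) v, ∃ u, α (.inl v) = .inl u :=
    fun α v => depth_eq_zero_iff.1 (by rw [depth_iso hk ht hG, depth_inl])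
  choose f hf using h
  refine ⟨⟨⟨f α, f α.symm, fun v => ?_, fun v => ?_⟩, fun {u v} => ?_⟩, hf α⟩
  · apply Sum.inl_injective (β := V × Fin t × Fin (k - 1))
    rw [← hf, ← hf, α.symm_apply_apply]
  · apply Sum.inl_injective (β := V × Fin t × Fin (k - 1))
    rw [← hf, ← hf, α.apply_symm_apply]
  · have := α.map_adj_iff (v := .inl u) (w := .inl v)
    rw [hf, hf] at this
    exact this

/-- An automorphism of `G` together with a permutation of the cycles at each vertex acts on the
multiplier graph. -/
def liftIso (k : ℕ) (β : G ≃g G) (σ : Equiv.Perm (Fin t)) :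
    multiplier G t k ≃g multiplier G t k where
  toEquiv := Equiv.sumCongr β.toEquiv (β.toEquiv.prodCongr (σ.prodCongr (Equiv.refl _)))
  map_rel_iff' := by
    rintro (u | ⟨u, j, i⟩) (v | ⟨v, j', i'⟩)
    · exact β.map_adj_iff
    · change (β u = β v ∧ _) ↔ (u = v ∧ _)
      rw [β.injective.eq_iff]; rfl
    · change (β v = β u ∧ _) ↔ (v = u ∧ _)
      rw [β.injective.eq_iff]; rfl
    · change (β u = β v ∧ σ j = σ j' ∧ _) ↔ (u = v ∧ j = j' ∧ _)
      rw [β.injective.eq_iff, σ.injective.eq_iff]; rfl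

/-- Reversing all attached cycles is an automorphism of the multiplier graph. -/
def reverseIso (G : SimpleGraph V) (t k : ℕ) : multiplier G t k ≃g multiplier G t k where
  toEquiv := Equiv.sumCongr (Equiv.refl V)
    ((Equiv.refl V).prodCongr ((Equiv.refl (Fin t)).prodCongr Fin.revPerm))
  map_rel_iff' := by
    rintro (u | ⟨u, j, i⟩) (v | ⟨v, j', i'⟩)
    · exact Iff.rfl
    · change (u = v ∧ (i'.rev.val = 0 ∨ i'.rev.val + 2 = k)) ↔ (u = v ∧ (i'.val = 0 ∨ i'.val + 2 = k))
      rw [Fin.val_rev]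
      refine and_congr_right fun _ => ?_
      omega
    · change (v = u ∧ (i.rev.val = 0 ∨ i.rev.val + 2 = k)) ↔ (v = u ∧ (i.val = 0 ∨ i.val + 2 = k))
      rw [Fin.val_rev]
      refine and_congr_right fun _ => ?_
      omega
    · change (u = v ∧ j = j' ∧ (i.rev.val + 1 = i'.rev.val ∨ i'.rev.val + 1 = i.rev.val)) ↔
        (u = v ∧ j = j' ∧ (i.val + 1 = i'.val ∨ i'.val + 1 = i.val))
      rw [Fin.val_rev, Fin.val_rev]
      refine and_congr_right fun _ => and_congr_right fun _ => ?_
      omega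

theorem liftIso_inl (β : G ≃g G) (σ : Equiv.Perm (Fin t)) (v : V) :
    liftIso k β σ (.inl v) = .inl (β v) := rfl

theorem liftIso_cycleVertex (β : G ≃g G) (σ : Equiv.Perm (Fin t)) (v : V) (j : Fin t) (i : ℕ) :
    liftIso k β σ (cycleVertex k v j i) = cycleVertex k (β v) (σ j) i := by
  rcases i with _ | i
  · rfl
  · by_cases h : i < k - 1
    · rw [cycleVertex_succ v j h, cycleVertex_succ _ _ h]; rfl
    · rw [cycleVertex_of_le v j (by omega), cycleVertex_of_le _ _ (by omega)]; rfl

theorem reverseIso_cycleVertex (v : V) (j : Fin t) {i : ℕ} (hi : i ≤ k) :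
    reverseIso G t k (cycleVertex k v j i) = cycleVertex k v j (k - i) := by
  rcases i with _ | i
  · rw [cycleVertex_of_le v j (Nat.sub_zero k).ge]; rfl
  · by_cases h : i < k - 1
    · rw [cycleVertex_succ v j h, show k - (i + 1) = (k - 1 - (i + 1)) + 1 by omega,
        cycleVertex_succ v j (by omega)]
      change Sum.inr (v, j, Fin.rev ⟨i, h⟩) = _
      congr
    · rw [cycleVertex_of_le v j (by omega), show k - (i + 1) = 0 by omega]; rfl

theorem exists_liftIso_cycleVertex (hG : ∀ u v : V, ∃ β : G ≃g G, β u = v) (k : ℕ) (u v : V)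
    (j j' : Fin t) : ∃ α : multiplier G t k ≃g multiplier G t k,
      ∀ i, α (cycleVertex k u j i) = cycleVertex k v j' i := by
  obtain ⟨β, rfl⟩ := hG u v
  exact ⟨liftIso k β (Equiv.swap j j'), fun i => by rw [liftIso_cycleVertex, Equiv.swap_apply_left]⟩

/-- Lifted symmetries and, if necessary, the reversal bring any vertex to one fixed cycle, at the
position equal to its depth. The largest depth is `⌊(4q - 1) / 2⌋ = 2q - 1`. -/
theorem numVertexOrbits_multiplier [Nonempty V] {q : ℕ} (hq : 1 ≤ q) (ht : 1 ≤ t)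
    (hG : ∀ v, ∃ u, G.Adj v u) (htrans : ∀ u v : V, ∃ β : G ≃g G, β u = v) :
    numVertexOrbits (multiplier G t (4 * q - 1)) = 2 * q := by
  have v₀ := Classical.arbitrary V
  have hnf : ∀ x : V ⊕ V × Fin t × Fin (4 * q - 1 - 1), depth x < 2 * q ∧
      ∃ α : multiplier G t (4 * q - 1) ≃g multiplier G t (4 * q - 1),
        α x = cycleVertex (4 * q - 1) v₀ ⟨0, ht⟩ (depth x) := by
    rintro (v | ⟨v, j, i⟩)
    · refine ⟨by rw [depth_inl]; omega, ?_⟩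
      obtain ⟨β, rfl⟩ := htrans v v₀
      exact ⟨liftIso _ β 1, rfl⟩
    · have hi := i.2
      obtain ⟨α, hα⟩ := exists_liftIso_cycleVertex htrans (4 * q - 1) v v₀ j ⟨0, ht⟩
      rw [inr_eq_cycleVertex, depth_cycleVertex]
      refine ⟨by omega, ?_⟩
      rcases le_total (i.val + 1) (4 * q - 1 - (i.val + 1)) with hle | hle
      · rw [min_eq_left hle]
        exact ⟨α, hα _⟩
      · rw [min_eq_right hle]
        refine ⟨α.trans (reverseIso G t _), ?_⟩
        rw [RelIso.trans_apply, hα, reverseIso_cycleVertex _ _ (by omega)]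
  refine card_quotient_eq _ depth _ ?_ ?_ (fun x => (hnf x).1) ?_
  · rintro x _ ⟨α, rfl⟩
    exact (depth_iso (by omega) ht hG α x).symm
  · intro x y hxy
    obtain ⟨-, α, hα⟩ := hnf x
    obtain ⟨-, β, hβ⟩ := hnf y
    refine ⟨α.trans β.symm, ?_⟩
    rw [RelIso.trans_apply, hα, hxy, ← hβ, RelIso.symm_apply_apply]
  · intro i hi
    exact ⟨cycleVertex (4 * q - 1) v₀ ⟨0, ht⟩ i, by rw [depth_cycleVertex]; omega⟩

end MultiplierAut

/-! ### Edge orbits over circulants -/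

section CircMultiplier

variable {n m k : ℕ}

/-- An invariant of the edges of the multiplier of a circulant graph which separates their orbits. -/
def edgeIndex (n m k : ℕ) :
    ZMod n ⊕ ZMod n × Fin m × Fin (k - 1) → ZMod n ⊕ ZMod n × Fin m × Fin (k - 1) → ℕ
  -- Chord lengths `1, …, m` fill the indices below `m`. A cycle edge gets `m` plus the rounded-down
  -- mean depth of its ends, which also covers the middle edge, whose ends have equal depth when `k`
  -- is odd.
  | .inl u, .inl v => min (u - v).val (v - u).val - 1
  | x, y => m + (depth x + depth y) / 2

theorem edgeIndex_inl (u v : ZMod n) :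
    edgeIndex n m k (.inl u) (.inl v) = min (u - v).val (v - u).val - 1 := rfl

theorem edgeIndex_of_depth_ne_zero {x y : ZMod n ⊕ ZMod n × Fin m × Fin (k - 1)}
    (h : depth x ≠ 0 ∨ depth y ≠ 0) : edgeIndex n m k x y = m + (depth x + depth y) / 2 := by
  rcases x with u | p <;> rcases y with v | p'
  · simp at h
  all_goals rfl

theorem edgeIndex_comm (x y : ZMod n ⊕ ZMod n × Fin m × Fin (k - 1)) :
    edgeIndex n m k x y = edgeIndex n m k y x := by
  rcases x with u | p <;> rcases y with v | p'
  · rw [edgeIndex_inl, edgeIndex_inl, min_comm]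
  all_goals exact congrArg (fun a => m + a / 2) (add_comm _ _)

/-- Depths are preserved, and on the base the automorphism is `x ↦ ±x + c`, which keeps or exchanges
the differences `u - v` and `v - u`. -/
theorem edgeIndex_iso (hk : 3 ≤ k) (hm : 1 ≤ m) (h : 2 * m + 3 ≤ n)
    (α : multiplier (circ n m) m k ≃g multiplier (circ n m) m k)
    (x y : ZMod n ⊕ ZMod n × Fin m × Fin (k - 1)) :
    edgeIndex n m k (α x) (α y) = edgeIndex n m k x y := by
  have hG : ∀ v, ∃ u, (circ n m).Adj v u := fun v => ⟨_, circ_adj_add_one hm h v⟩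
  by_cases hxy : depth x ≠ 0 ∨ depth y ≠ 0
  · rw [edgeIndex_of_depth_ne_zero hxy, edgeIndex_of_depth_ne_zero, depth_iso hk hm hG,
      depth_iso hk hm hG]
    rwa [depth_iso hk hm hG, depth_iso hk hm hG]
  · push Not at hxy
    obtain ⟨u, rfl⟩ := depth_eq_zero_iff.1 hxy.1
    obtain ⟨v, rfl⟩ := depth_eq_zero_iff.1 hxy.2
    obtain ⟨β, hβ⟩ := exists_base_iso hk hm hG α
    obtain ⟨ε, rfl | rfl, hε⟩ := circ_iso_affine hm h β
    · rw [hβ, hβ, edgeIndex_inl, edgeIndex_inl, hε u, hε v]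
      ring_nf
    · rw [hβ, hβ, edgeIndex_inl, edgeIndex_inl, hε u, hε v, min_comm]
      ring_nf

theorem edgeIndex_inl_add (h : 2 * m + 3 ≤ n) (u : ZMod n) {i : ℕ} (hi1 : 1 ≤ i) (hi : i ≤ m) :
    edgeIndex n m k (.inl u) (.inl (u + i)) = i - 1 := by
  have : NeZero n := ⟨by omega⟩
  have e1 : u - (u + (i : ZMod n)) = ((n - i : ℕ) : ZMod n) := by
    rw [Nat.cast_sub (by omega), ZMod.natCast_self]; ring
  rw [edgeIndex_inl, e1, add_sub_cancel_left, ZMod.val_cast_of_lt (by omega),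
    ZMod.val_cast_of_lt (by omega)]
  omega

theorem edgeIndex_cycleVertex (v : ZMod n) (j : Fin m) (hk : 3 ≤ k) {a : ℕ} (ha : a < k) :
    edgeIndex n m k (cycleVertex k v j a) (cycleVertex k v j (a + 1)) =
      m + min a (k - 1 - a) := by
  rw [edgeIndex_of_depth_ne_zero] <;> simp only [depth_cycleVertex] <;> omega

theorem circ_translate (h : 2 * m + 3 ≤ n) (u v : ZMod n) : ∃ β : circ n m ≃g circ n m, β u = v :=
  ⟨circAffine h 1 (v - u), by simp⟩

/-- The representative depends only on the index, so edges of equal index lie in one orbit.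
Translations normalise chords; reversal folds cycle edge `i` onto `4q - 2 - i`. -/
theorem exists_iso_edge {q : ℕ} (hq : 1 ≤ q) (hm : 1 ≤ m) (h : 2 * m + 3 ≤ n)
    {x y : ZMod n ⊕ ZMod n × Fin m × Fin (4 * q - 1 - 1)}
    (hxy : (multiplier (circ n m) m (4 * q - 1)).Adj x y) :
    (∃ i < m, edgeIndex n m (4 * q - 1) x y = i ∧
      ∃ α : multiplier (circ n m) m (4 * q - 1) ≃g multiplier (circ n m) m (4 * q - 1),
        Sym2.map α s(x, y) = s(.inl 0, .inl (0 + (i + 1 : ℕ)))) ∨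
    (∃ a < 2 * q, edgeIndex n m (4 * q - 1) x y = m + a ∧
      ∃ α : multiplier (circ n m) m (4 * q - 1) ≃g multiplier (circ n m) m (4 * q - 1),
        Sym2.map α s(x, y) = s(cycleVertex _ 0 ⟨0, hm⟩ a, cycleVertex _ 0 ⟨0, hm⟩ (a + 1))) := by
  have hbase : ∀ (u : ZMod n) (i : ℕ), 1 ≤ i → i ≤ m → ∃ i' < m,
      edgeIndex n m (4 * q - 1) (.inl u) (.inl (u + i)) = i' ∧
      ∃ α : multiplier (circ n m) m (4 * q - 1) ≃g multiplier (circ n m) m (4 * q - 1),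
        Sym2.map α s(.inl u, .inl (u + i)) = s(.inl 0, .inl (0 + (i' + 1 : ℕ))) := by
    intro u i h1 h2
    refine ⟨i - 1, by omega, edgeIndex_inl_add h u h1 h2,
      liftIso _ (circAffine h 1 (-u)) 1, ?_⟩
    rw [Sym2.map_mk, liftIso_inl, liftIso_inl, circAffine_apply, circAffine_apply,
      Nat.sub_add_cancel h1]
    simp
  have hcycle : ∀ (v : ZMod n) (j : Fin m) (i : ℕ), i < 4 * q - 1 → ∃ a < 2 * q,
      edgeIndex n m (4 * q - 1) (cycleVertex _ v j i) (cycleVertex _ v j (i + 1)) = m + a ∧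
      ∃ α : multiplier (circ n m) m (4 * q - 1) ≃g multiplier (circ n m) m (4 * q - 1),
        Sym2.map α s(cycleVertex _ v j i, cycleVertex _ v j (i + 1)) =
          s(cycleVertex _ 0 ⟨0, hm⟩ a, cycleVertex _ 0 ⟨0, hm⟩ (a + 1)) := by
    intro v j i hi
    obtain ⟨α, hα⟩ := exists_liftIso_cycleVertex (circ_translate h) (4 * q - 1) v 0 j ⟨0, hm⟩
    refine ⟨min i (4 * q - 1 - 1 - i), by omega, edgeIndex_cycleVertex v j (by omega) hi, ?_⟩
    rcases le_total i (4 * q - 1 - 1 - i) with hle | hle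
    · rw [min_eq_left hle]
      exact ⟨α, by rw [Sym2.map_mk, hα, hα]⟩
    · rw [min_eq_right hle]
      refine ⟨α.trans (reverseIso _ _ _), ?_⟩
      rw [Sym2.map_mk, RelIso.trans_apply, RelIso.trans_apply, hα, hα,
        reverseIso_cycleVertex _ _ hi.le, reverseIso_cycleVertex _ _ (by omega), Sym2.eq_swap,
        show 4 * q - 1 - (i + 1) = 4 * q - 1 - 1 - i by omega,
        show 4 * q - 1 - i = 4 * q - 1 - 1 - i + 1 by omega]
  have hinr : ∀ v j i y, (multiplier (circ n m) m (4 * q - 1)).Adj (.inr (v, j, i)) y → ∃ a < 2 * q,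
      edgeIndex n m (4 * q - 1) (.inr (v, j, i)) y = m + a ∧
      ∃ α : multiplier (circ n m) m (4 * q - 1) ≃g multiplier (circ n m) m (4 * q - 1),
        Sym2.map α s(.inr (v, j, i), y) =
          s(cycleVertex _ 0 ⟨0, hm⟩ a, cycleVertex _ 0 ⟨0, hm⟩ (a + 1)) := by
    intro v j i y hy
    rw [multiplier_adj_inr_iff] at hy
    have hi := i.2
    rw [inr_eq_cycleVertex]
    rcases hy with rfl | rfl
    · rw [edgeIndex_comm, Sym2.eq_swap]
      exact hcycle v j i (by omega)
    · exact hcycle v j (i + 1) (by omega)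
  rcases x with u | ⟨u, j, i⟩
  · rcases y with v | ⟨v, j', i'⟩
    · left
      obtain ⟨i, h1, h2, rfl | rfl⟩ := (circ_adj h).1 (show (circ n m).Adj u v from hxy)
      · exact hbase u i h1 h2
      · rw [edgeIndex_comm, Sym2.eq_swap]
        exact hbase v i h1 h2
    · right
      rw [edgeIndex_comm, Sym2.eq_swap]
      exact hinr _ _ _ _ hxy.symm
  · exact Or.inr (hinr _ _ _ _ hxy)

theorem numEdgeOrbits_multiplier_circ {q : ℕ} (hq : 1 ≤ q) (hm : 1 ≤ m) (h : 2 * m + 3 ≤ n) :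
    numEdgeOrbits (multiplier (circ n m) m (4 * q - 1)) = m + 2 * q := by
  have hk : 3 ≤ 4 * q - 1 := by omega
  refine card_quotient_eq _
    (fun e => Sym2.lift ⟨edgeIndex n m (4 * q - 1), edgeIndex_comm⟩ e.1) _ ?_ ?_ ?_ ?_
  · rintro ⟨e, he⟩ ⟨_, hf⟩ ⟨α, rfl⟩
    induction e with | _ x y
    exact (edgeIndex_iso hk hm h α x y).symm
  · rintro ⟨e, he⟩ ⟨f, hf⟩ hef
    induction e with | _ x y
    induction f with | _ x' y'
    have hef' : edgeIndex n m (4 * q - 1) x y = edgeIndex n m (4 * q - 1) x' y' := hef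
    have hcomp : ∀ (α β : multiplier (circ n m) m (4 * q - 1) ≃g multiplier (circ n m) m (4 * q - 1)),
        Sym2.map α s(x, y) = Sym2.map β s(x', y') →
        ∃ γ : multiplier (circ n m) m (4 * q - 1) ≃g multiplier (circ n m) m (4 * q - 1),
          Sym2.map γ s(x, y) = s(x', y') := by
      intro α β hαβ
      refine ⟨α.trans β.symm, Sym2.map.injective β.injective ?_⟩
      rw [← hαβ, Sym2.map_mk, Sym2.map_mk, Sym2.map_mk]
      simp
    rcases exists_iso_edge (x := x) (y := y) hq hm h he with ⟨i, hi, e1, α, hα⟩ | ⟨i, hi, e1, α, hα⟩ <;>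
      rcases exists_iso_edge (x := x') (y := y') hq hm h hf with ⟨i', hi', e2, β, hβ⟩ | ⟨i', hi', e2, β, hβ⟩
    · obtain rfl : i = i' := by omega
      exact hcomp α β (hα.trans hβ.symm)
    · omega
    · omega
    · obtain rfl : i = i' := by omega
      exact hcomp α β (hα.trans hβ.symm)
  · rintro ⟨e, he⟩
    induction e with | _ x y
    change edgeIndex n m (4 * q - 1) x y < _
    rcases exists_iso_edge (x := x) (y := y) hq hm h he with ⟨i, hi, e1, -⟩ | ⟨i, hi, e1, -⟩ <;> omega
  · intro i hi
    by_cases him : i < m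
    · refine ⟨⟨s(.inl 0, .inl (0 + (i + 1 : ℕ))), ?_⟩, edgeIndex_inl_add (k := 4 * q - 1) h 0 (by omega) (by omega)⟩
      exact (circ_adj h).2 ⟨i + 1, by omega, by omega, Or.inl rfl⟩
    · refine ⟨⟨s(cycleVertex _ 0 ⟨0, hm⟩ (i - m), cycleVertex _ 0 ⟨0, hm⟩ (i - m + 1)),
        cycleVertex_adj _ _ hk (by omega)⟩, ?_⟩
      refine (edgeIndex_cycleVertex 0 ⟨0, hm⟩ hk (by omega)).trans ?_
      omega

theorem circ_preconnected (hm : 1 ≤ m) (h : 2 * m + 3 ≤ n) : (circ n m).Preconnected := by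
  have : NeZero n := ⟨by omega⟩
  have h0 : ∀ k : ℕ, (circ n m).Reachable 0 k := by
    intro k
    induction k with
    | zero => simp
    | succ k ih =>
      rw [Nat.cast_succ]
      exact ih.trans (circ_adj_add_one hm h _).reachable
  have h1 : ∀ v, (circ n m).Reachable 0 v := fun v => by simpa using h0 v.val
  exact fun u v => (h1 u).symm.trans (h1 v)

theorem hasNutKernel_multiplier_circ [NeZero n] {q : ℕ} (hq : 1 ≤ q) (hm : 1 ≤ m)
    (h : 2 * m + 3 ≤ n) : HasNutKernel (multiplier (circ n m) m (4 * q - 1)) :=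
  hasNutKernel_multiplier hq (circ_preconnected hm h) (circ_ncard_neighborSet h)

theorem numVertexOrbits_multiplier_circ {q : ℕ} (hq : 1 ≤ q) (hm : 1 ≤ m) (h : 2 * m + 3 ≤ n) :
    numVertexOrbits (multiplier (circ n m) m (4 * q - 1)) = 2 * q :=
  numVertexOrbits_multiplier hq hm (fun v => ⟨_, circ_adj_add_one hm h v⟩) (circ_translate h)

end CircMultiplier

end NutGraph
-- The main theorem
open NutGraph in
theorem mainTheorem6 :
    -- infinitely many pairwise non-isomorphic nut graphs with `r` vertex and `k` edge orbits
    (∀ r k : ℕ, Even r → 2 ≤ r → r + 1 ≤ k →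
      ∃ (n : ℕ → ℕ) (G : (i : ℕ) → SimpleGraph (Fin (n i))),
        (∀ i j, i ≠ j → IsEmpty (G i ≃g G j)) ∧
        ∀ i, IsNut (G i) ∧ numVertexOrbits (G i) = r ∧ numEdgeOrbits (G i) = k) ∧
    -- the circulants are regular and have dihedral automorphism group
    (∀ m n : ℕ, 1 ≤ m → 2 * m + 3 ≤ n →
      (∀ v, ((circ n m).neighborSet v).ncard = 2 * m) ∧
      Nonempty ((circ n m ≃g circ n m) ≃* DihedralGroup n)) ∧
    -- the explicit family realizing all these orbit counts
    (∀ q m n : ℕ, 1 ≤ q → 1 ≤ m → 2 * m + 3 ≤ n → ∀ [NeZero n],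
      IsNut (multiplier (circ n m) m (4 * q - 1)) ∧
      numVertexOrbits (multiplier (circ n m) m (4 * q - 1)) = 2 * q ∧
      numEdgeOrbits (multiplier (circ n m) m (4 * q - 1)) = m + 2 * q) := by
  refine ⟨?_, ?_, ?_⟩
  · intro r k hr hr2 hrk
    obtain ⟨q, rfl⟩ := even_iff_two_dvd.1 hr
    obtain ⟨m, rfl⟩ : ∃ m, k = m + 2 * q := ⟨k - 2 * q, by omega⟩
    have hq : 1 ≤ q := by omega
    have hm : 1 ≤ m := by omega
    -- With `q` and `m` fixed, larger circulants give strictly more vertices, hence pairwise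
    -- non-isomorphic multipliers.
    let N : ℕ → ℕ := fun i => 2 * m + 3 + i
    have hN : ∀ i, NeZero (N i) := fun i => ⟨by simp only [N]; omega⟩
    have hle : ∀ i, 2 * m + 3 ≤ N i := fun i => Nat.le_add_right _ _
    let c : ℕ → ℕ := fun i => N i + N i * (m * (4 * q - 1 - 1))
    have hc : ∀ i, Fintype.card (ZMod (N i) ⊕ ZMod (N i) × Fin m × Fin (4 * q - 1 - 1)) = c i :=
      fun i => by simp [c, ZMod.card]
    refine ⟨c, fun i => (multiplier (circ (N i) m) m (4 * q - 1)).overFin (hc i), ?_, fun i => ?_⟩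
    · refine fun i j hij => ⟨fun e => hij ?_⟩
      have hcard : c i = c j := by simpa using Fintype.card_congr e.toEquiv
      have : StrictMono c := by
        intro a b hab
        have : N a < N b := Nat.add_lt_add_left hab _
        exact Nat.add_lt_add_of_lt_of_le this (Nat.mul_le_mul_right _ this.le)
      exact this.injective hcard
    · have e := (multiplier (circ (N i) m) m (4 * q - 1)).overFinIso (hc i)
      have : Nonempty (Fin (c i)) := ⟨e (.inl 0)⟩
      refine ⟨((hasNutKernel_multiplier_circ hq hm (hle i)).of_iso e.symm).isNut, ?_, ?_⟩
      · rw [← numVertexOrbits_congr e, numVertexOrbits_multiplier_circ hq hm (hle i)]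
      · rw [← numEdgeOrbits_congr e, numEdgeOrbits_multiplier_circ hq hm (hle i)]
  · intro m n hm h
    exact ⟨circ_ncard_neighborSet h,
      ⟨(MulEquiv.ofBijective (dihedralToAut h) (dihedralToAut_bijective hm h)).symm⟩⟩
  · intro q m n hq hm h _
    exact ⟨(hasNutKernel_multiplier_circ hq hm h).isNut, numVertexOrbits_multiplier_circ hq hm h,
      numEdgeOrbits_multiplier_circ hq hm h⟩
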